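/- Let $\mathcal H$ be a real Hilbert space, $m\ge 1$, and let $F:\mathcal H\to\mathcal H$ be $\eta$-strongly monotone ($\langle Fx-Fy,x-y\rangle\ge\eta\|x-y\|^2$ for all $x,y\in\mathcal H$) and $\kappa$-Lipschitz continuous, with $\eta,\kappa>0$. Let $c_1,\dots,c_{m-1}:\mathcal H\to\mathbb R$ be continuous convex functions, put $C_i:=\{x\in\mathcal H: c_i(x)\le 0\}$ for $1\le i\le m-1$, let $C_m\subset\mathcal H$ be closed, convex and bounded, and assume that $C:=\bigcap_{i=1}^m C_i\ne\emptyset$. For $1\le i\le m-1$ and each $x\in\mathcal H$ let $g_i(x)\in\partial c_i(x):=\{g\in\mathcal H:\langle g,z-x\rangle\le c_i(z)-c_i(x)\ \forall z\in\mathcal H\}$ be a fixed choice of subgradient, and let $\mathrm{proj}_{C_m}$ be the metric projection onto $C_m$. Let $\mu\in(0,2\eta/\kappa^2)$, $\{\beta_n\}_{n\ge1}\subset(0,1]$, $\{\varphi_n\}_{n\ge1}\subset[0,\infty)$ and $\{\lambda_n\}_{n\ge1}\subset(0,\infty)$. Choose $x^1\in C_m$, set $d^1:=-F(x^1)$, and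 for $n=1,2,\dots$ compute $y^n:=x^n+\mu\beta_n d^n$; $u_0^n:=y^n$; for $i=1,\dots,m-1$, $$u_i^n:=u_{i-1}^n-\frac{\max\{c_i(u_{i-1}^n),0\}}{\|g_i(u_{i-1}^n)\|^2}\,g_i(u_{i-1}^n)$$ (with the quotient read as $0$ when $c_i(u_{i-1}^n)\le 0$); $u_m^n:=\mathrm{proj}_{C_m}u_{m-1}^n$; the step size $\sigma(y^n):=1$ if $y^n\in C$ and otherwise $$\sigma(y^n):=\frac{1}{\|u_m^n-y^n\|^2}\left(\langle u_m^n-y^n,u_m^n-u_{m-1}^n\rangle-\sum_{i=1}^{m-1}\frac{\max\{c_i(u_{i-1}^n),0\}}{\|g_i(u_{i-1}^n)\|^2}\langle u_{i-1}^n-y^n,g_i(u_{i-1}^n)\rangle+\sum_{i=1}^{m-1}\Big(\frac{\max\{c_i(u_{i-1}^n),0\}}{\|g_i(u_{i-1}^n)\|}\Big)^2\right);$$ and finally $$x^{n+1}:=\mathrm{proj}_{C_m}\big(y^n+\lambda_n\sigma(y^n)(u_m^n-y^n)\big),\qquad d^{n+1}:=-F(x^{n+1})+\varphi_{n+1}d^n.$$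 Suppose that $\lim_{n\to\infty}\beta_n=0$, $\sum_{n=1}^\infty\beta_n=\infty$, $\lim_{n\to\infty}\varphi_n=0$, and $\{\lambda_n\}_{n\ge1}\subset[\varepsilon,2-\varepsilon]$ for some $\varepsilon\in(0,1)$. Suppose further that one of the following holds: (i) each $c_i$, $1\le i\le m-1$, is Lipschitz continuous on every bounded subset of $\mathcal H$; (ii) each $c_i$, $1\le i\le m-1$, is bounded on every bounded subset of $\mathcal H$; (iii) each subdifferential $\partial c_i$, $1\le i\le m-1$, maps bounded subsets of $\mathcal H$ to bounded sets. Then the variational inequality problem of finding $\bar u\in C$ with $\langle F(\bar u),z-\bar u\rangle\ge0$ for all $z\in C$ has a unique solution $\bar u$, and $\{x^n\}_{n\ge1}$ converges strongly (in norm) to $\bar u$. -/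

import Mathlib

open Filter Topology
open scoped NNReal

noncomputable section

variable {H : Type*} [NormedAddCommGroup H] [InnerProductSpace ℝ H]

/-- `F` is `η`-strongly monotone, `η > 0`. -/
def StronglyMonotoneOp (η : ℝ) (F : H → H) : Prop :=
  0 < η ∧ ∀ x y : H, η * ‖x - y‖ ^ 2 ≤ inner ℝ (F x - F y) (x - y)

/-- `F` is `κ`-Lipschitz continuous, `κ > 0`. -/
def LipschitzOp (κ : ℝ) (F : H → H) : Prop :=
  0 < κ ∧ ∀ x y : H, ‖F x - F y‖ ≤ κ * ‖x - y‖

/-- The subdifferential `∂f(x)` of `f : H → ℝ`. -/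
def subdiff (f : H → ℝ) (x : H) : Set H :=
  {g | ∀ y : H, inner ℝ g (y - x) ≤ f y - f x}

/-- The subgradient projection relative to `f`, for a selection `g` of subgradients of `f`. -/
def subgradProj (f : H → ℝ) (g : H → H) (x : H) : H :=
  open Classical in
  if 0 < f x then x - (f x / ‖g x‖ ^ 2) • g x else x

/-- The metric projection of `x` onto `K`: a point of `K` at minimal distance from `x`
(it exists and is unique when `K` is nonempty, closed, convex and `H` is complete). -/
def metricProj (K : Set H) (x : H) : H :=
  Classical.epsilon fun p => p ∈ K ∧ ‖x - p‖ = ⨅ y : K, ‖x - y‖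

theorem metricProj_spec [CompleteSpace H] {K : Set H} (hne : K.Nonempty) (hcl : IsClosed K)
    (hcv : Convex ℝ K) (x : H) :
    metricProj K x ∈ K ∧ ‖x - metricProj K x‖ = ⨅ y : K, ‖x - y‖ :=
  Classical.epsilon_spec (p := fun p => p ∈ K ∧ ‖x - p‖ = ⨅ y : K, ‖x - y‖)
    (exists_norm_eq_iInf_of_complete_convex hne hcl.isComplete hcv x)

/-- The constraint set `C = C₁ ∩ ⋯ ∩ C_m`, where `C_i = {x | c i x ≤ 0}` for `1 ≤ i ≤ m - 1` and
`C_m = K`. -/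
def constraintSet (m : ℕ) (c : ℕ → H → ℝ) (K : Set H) : Set H :=
  (⋂ i ∈ Finset.Icc 1 (m - 1), {x : H | c i x ≤ 0}) ∩ K

/-- `u` solves the variational inequality `VIP(F, C)`. -/
def IsVIPSolution (F : H → H) (C : Set H) (u : H) : Prop :=
  u ∈ C ∧ ∀ z ∈ C, 0 ≤ inner ℝ (F u) (z - u)

/-- `u₀ = y` and `u_i = P_{c_i} u_{i-1}`, the successive subgradient projections of `y`
(used for `i ≤ m - 1`). -/
def subgradChain (c : ℕ → H → ℝ) (g : ℕ → H → H) (y : H) : ℕ → H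
  | 0 => y
  | i + 1 => subgradProj (c (i + 1)) (g (i + 1)) (subgradChain c g y i)

/-- `T y = proj_K P_{c_{m-1}} ⋯ P_{c_1} y`, that is, `u_m`. -/
def cyclicOp (m : ℕ) (c : ℕ → H → ℝ) (g : ℕ → H → H) (K : Set H) (y : H) : H :=
  metricProj K (subgradChain c g y (m - 1))

/-- The extrapolation step size `σ(y)`. -/
def stepSize (m : ℕ) (c : ℕ → H → ℝ) (g : ℕ → H → H) (K : Set H) (y : H) : ℝ :=
  let u := subgradChain c g y
  let Ty := cyclicOp m c g K y
  open Classical in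
  if y ∈ constraintSet m c K then 1
  else
    (inner ℝ (Ty - y) (Ty - u (m - 1))
      - ∑ i ∈ Finset.Icc 1 (m - 1),
          (max (c i (u (i - 1))) 0 / ‖g i (u (i - 1))‖ ^ 2)
            * inner ℝ (u (i - 1) - y) (g i (u (i - 1)))
      + ∑ i ∈ Finset.Icc 1 (m - 1),
          (max (c i (u (i - 1))) 0 / ‖g i (u (i - 1))‖) ^ 2)
      / ‖Ty - y‖ ^ 2

/-- The sequences `(x n)`, `(y n)`, `(d n)`, `n ≥ 1`, are generated by the extrapolated sequential
constraint method with conjugate gradient direction (the values at `n = 0` play no role). -/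
structure IsESCoMCGD (m : ℕ) (F : H → H) (c : ℕ → H → ℝ) (g : ℕ → H → H) (K : Set H)
    (μ : ℝ) (β φ lam : ℕ → ℝ) (x y d : ℕ → H) : Prop where
  x_one : x 1 ∈ K
  d_one : d 1 = -F (x 1)
  y_eq : ∀ n, 1 ≤ n → y n = x n + (μ * β n) • d n
  x_succ : ∀ n, 1 ≤ n → x (n + 1) =
    metricProj K (y n + (lam n * stepSize m c g K (y n)) • (cyclicOp m c g K (y n) - y n))
  d_succ : ∀ n, 1 ≤ n → d (n + 1) = -F (x (n + 1)) + φ (n + 1) • d n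

/-- `f` is Lipschitz continuous relative to every bounded set. -/
def LipschitzOnBounded (f : H → ℝ) : Prop :=
  ∀ B : Set H, Bornology.IsBounded B → ∃ L : ℝ≥0, LipschitzOnWith L f B

/-- `f` is bounded on every bounded set. -/
def BoundedOnBounded (f : H → ℝ) : Prop :=
  ∀ B : Set H, Bornology.IsBounded B → Bornology.IsBounded (f '' B)

/-- `∂f` maps every bounded set to a bounded set. -/
def SubdiffBoundedOnBounded (f : H → ℝ) : Prop :=
  ∀ B : Set H, Bornology.IsBounded B → Bornology.IsBounded (⋃ x ∈ B, subdiff f x)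

end

/-! ### Metric projections and nested convex sets -/

section MetricProjection

variable {H : Type*} [NormedAddCommGroup H] [InnerProductSpace ℝ H] [CompleteSpace H]

/-! Let `u` solve the variational inequality, `T = cyclicOp` and `a n = ‖x n - u‖ ^ 2`. Two
estimates combine into `a (n + 1) ≤ (1 - τ β n) a n + β n δ n - s n`. The direction step contracts
towards `u` at rate `τ = μ (2η - μκ²)`, up to `β n δ n` (`norm_conjugateStep_sub_sq_le`). The
extrapolated step loses at least `s n = ε² S`, where `S` sums the squared displacements from `y n`
to `T (y n)` (`norm_extrapolated_sub_sq_le`).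

If `s n` is not small, it beats `β n δ n`, because `β n → 0` and `δ n` is bounded above. If `s n` is
small, bounded subgradients make `x n` almost feasible (`constraint_le_of_small_displacement`), and
on almost feasible points of `Cm` the inner product with `F u` is almost nonnegative
(`exists_neg_le_inner_of_almost_feasible`), so `δ n` is eventually below any given `e > 0`. With `∑
β n = ∞`, `tendsto_zero_of_perturbed_descent` gives `a n → 0`. -/

theorem metricProj_inner_le_zero {K : Set H} (hne : K.Nonempty) (hcl : IsClosed K)
    (hcv : Convex ℝ K) (x : H) {w : H} (hw : w ∈ K) :
    inner ℝ (x - metricProj K x) (w - metricProj K x) ≤ 0 :=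
  (norm_eq_iInf_iff_real_inner_le_zero hcv (metricProj_spec hne hcl hcv x).1).1
    (metricProj_spec hne hcl hcv x).2 w hw

theorem norm_metricProj_sub_metricProj_le {K : Set H} (hne : K.Nonempty) (hcl : IsClosed K)
    (hcv : Convex ℝ K) (x y : H) : ‖metricProj K x - metricProj K y‖ ≤ ‖x - y‖ := by
  have h1 := metricProj_inner_le_zero hne hcl hcv x (metricProj_spec hne hcl hcv y).1
  have h2 := metricProj_inner_le_zero hne hcl hcv y (metricProj_spec hne hcl hcv x).1
  set p := metricProj K x
  set q := metricProj K y
  have h3 : ‖p - q‖ ^ 2 ≤ inner ℝ (x - y) (p - q) := by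
    rw [← real_inner_self_eq_norm_sq]
    simp only [inner_sub_left, inner_sub_right] at h1 h2 ⊢
    linarith
  have h4 := real_inner_le_norm (x - y) (p - q)
  by_contra! h
  nlinarith [norm_nonneg (x - y)]

theorem metricProj_eq_self {K : Set H} (hne : K.Nonempty) (hcl : IsClosed K)
    (hcv : Convex ℝ K) {x : H} (hx : x ∈ K) : metricProj K x = x := by
  have h := metricProj_inner_le_zero hne hcl hcv x hx
  rw [real_inner_self_nonpos, sub_eq_zero] at h
  exact h.symm

/-- A decreasing sequence of nonempty closed convex subsets of a Hilbert space, the first of which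
is bounded, has a common point. -/
theorem nonempty_iInter_of_antitone_closed_convex {Q : ℕ → Set H} (hQ : Antitone Q)
    (hne : ∀ k, (Q k).Nonempty) (hcl : ∀ k, IsClosed (Q k)) (hcv : ∀ k, Convex ℝ (Q k))
    (hb : Bornology.IsBounded (Q 0)) : (⋂ k, Q k).Nonempty := by
  set p : ℕ → H := fun k => metricProj (Q k) 0
  have hp : ∀ k, p k ∈ Q k := fun k => (metricProj_spec (hne k) (hcl k) (hcv k) 0).1
  -- Minimal-norm points of nested sets have increasing norms, and the obtuse angle at `p k` bounds
  -- their distances by the increments of the squared norms.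
  have key : ∀ k l, k ≤ l → ‖p l - p k‖ ^ 2 ≤ ‖p l‖ ^ 2 - ‖p k‖ ^ 2 := by
    intro k l hkl
    have h := metricProj_inner_le_zero (hne k) (hcl k) (hcv k) 0 (hQ hkl (hp l))
    change inner ℝ (0 - p k) (p l - p k) ≤ 0 at h
    rw [zero_sub, inner_neg_left, inner_sub_right, real_inner_self_eq_norm_sq] at h
    rw [norm_sub_sq_real, real_inner_comm]
    linarith
  have hmono : Monotone fun k => ‖p k‖ ^ 2 := fun k l hkl => by
    have := key k l hkl
    have h0 := sq_nonneg ‖p l - p k‖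
    change ‖p k‖ ^ 2 ≤ ‖p l‖ ^ 2
    linarith
  obtain ⟨R, hR⟩ := hb.exists_norm_le
  have hbdd : BddAbove (Set.range fun k => ‖p k‖ ^ 2) := by
    refine ⟨R ^ 2, ?_⟩
    rintro _ ⟨k, rfl⟩
    exact pow_le_pow_left₀ (norm_nonneg _) (hR _ (hQ (Nat.zero_le k) (hp k))) 2
  have hcs : CauchySeq fun k => ‖p k‖ ^ 2 := (tendsto_atTop_ciSup hmono hbdd).cauchySeq
  have hcp : CauchySeq p := by
    rw [Metric.cauchySeq_iff'] at hcs ⊢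
    intro e he
    obtain ⟨N, hN⟩ := hcs (e ^ 2) (by positivity)
    refine ⟨N, fun n hn => ?_⟩
    have h1 := hN n hn
    rw [Real.dist_eq] at h1
    rw [dist_eq_norm]
    have h2 := key N n hn
    exact lt_of_pow_lt_pow_left₀ 2 he.le (by linarith [le_abs_self (‖p n‖ ^ 2 - ‖p N‖ ^ 2)])
  obtain ⟨q, hq⟩ := cauchySeq_tendsto_of_complete hcp
  refine ⟨q, Set.mem_iInter.2 fun k => (hcl k).mem_of_tendsto hq ?_⟩
  filter_upwards [eventually_ge_atTop k] with n hn using hQ hn (hp n)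

end MetricProjection

/-! ### The variational inequality -/

section VariationalInequality

variable {H : Type*} [NormedAddCommGroup H] [InnerProductSpace ℝ H]

/-- Expanding the square leaves a term in `b ^ 2`; `b ≤ 1` turns it into one in `b`, so the
contraction is linear in `b`. -/
theorem norm_gradientStep_sub_sq_le {F : H → H} {η κ μ b : ℝ} (hF : StronglyMonotoneOp η F)
    (hL : LipschitzOp κ F) (hμ : 0 < μ) (hb0 : 0 ≤ b) (hb1 : b ≤ 1) (x y : H) :
    ‖(x - (μ * b) • F x) - (y - (μ * b) • F y)‖ ^ 2
      ≤ (1 - μ * (2 * η - μ * κ ^ 2) * b) * ‖x - y‖ ^ 2 := by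
  have e : (x - (μ * b) • F x) - (y - (μ * b) • F y)
      = (x - y) - (μ * b) • (F x - F y) := by
    rw [smul_sub]; abel
  have h1 := hF.2 x y
  have h2 : ‖F x - F y‖ ^ 2 ≤ κ ^ 2 * ‖x - y‖ ^ 2 := by
    rw [← mul_pow]; exact pow_le_pow_left₀ (norm_nonneg _) (hL.2 x y) 2
  rw [e, norm_sub_sq_real, inner_smul_right, norm_smul, mul_pow, Real.norm_eq_abs, sq_abs,
    real_inner_comm]
  have h3 : 2 * (μ * b) * (η * ‖x - y‖ ^ 2)
      ≤ 2 * (μ * b) * inner ℝ (F x - F y) (x - y) := by gcongr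
  have h4 : (μ * b) ^ 2 * ‖F x - F y‖ ^ 2 ≤ (μ ^ 2 * b) * (κ ^ 2 * ‖x - y‖ ^ 2) := by
    have : (μ * b) ^ 2 ≤ μ ^ 2 * b := by
      rw [mul_pow]; gcongr; nlinarith
    gcongr
  linarith

theorem relaxation_modulus_pos {η κ μ : ℝ} (hκ : 0 < κ) (hμ : μ ∈ Set.Ioo 0 (2 * η / κ ^ 2)) :
    0 < μ * (2 * η - μ * κ ^ 2) := by
  have h := hμ.2
  rw [lt_div_iff₀ (by positivity)] at h
  exact mul_pos hμ.1 (by linarith)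

theorem IsVIPSolution.eq {F : H → H} {η : ℝ} (hF : StronglyMonotoneOp η F) {C : Set H} {u v : H}
    (hu : IsVIPSolution F C u) (hv : IsVIPSolution F C v) : v = u := by
  have h1 := hu.2 v hv.1
  have h2 := hv.2 u hu.1
  have h3 := hF.2 v u
  have h4 : inner ℝ (F v - F u) (v - u) ≤ 0 := by
    rw [← neg_sub v u, inner_neg_right] at h2
    rw [inner_sub_left]; linarith
  have h5 : ‖v - u‖ ^ 2 ≤ 0 := by
    by_contra! h
    nlinarith [mul_pos hF.1 h]
  exact sub_eq_zero.1 (norm_eq_zero.1 (pow_eq_zero_iff (two_ne_zero)|>.1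
    (le_antisymm h5 (sq_nonneg _))))

theorem exists_isVIPSolution [CompleteSpace H] {F : H → H} {η κ μ : ℝ}
    (hF : StronglyMonotoneOp η F) (hL : LipschitzOp κ F) (hμ : μ ∈ Set.Ioo 0 (2 * η / κ ^ 2))
    {C : Set H} (hne : C.Nonempty) (hcl : IsClosed C) (hcv : Convex ℝ C) :
    ∃ u, IsVIPSolution F C u := by
  have hτ := relaxation_modulus_pos hL.1 hμ
  set τ := μ * (2 * η - μ * κ ^ 2)
  -- In the zero space nothing forces `η ≤ κ`, so `1 - τ` may be negative.
  set q : ℝ := √(max (1 - τ) 0)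
  have hq2 : q ^ 2 = max (1 - τ) 0 := Real.sq_sqrt (le_max_right _ _)
  have hq1 : q < 1 := by
    refine lt_of_pow_lt_pow_left₀ 2 zero_le_one ?_
    rw [hq2]; exact max_lt (by linarith) (by norm_num)
  have hcontr : ContractingWith ⟨q, Real.sqrt_nonneg _⟩
      (fun x : H => metricProj C (x - μ • F x)) := by
    refine ⟨by exact_mod_cast hq1, LipschitzWith.of_dist_le_mul fun x y => ?_⟩
    rw [dist_eq_norm, dist_eq_norm]
    refine (norm_metricProj_sub_metricProj_le hne hcl hcv _ _).trans ?_
    refine le_of_sq_le_sq ?_ (mul_nonneg (Real.sqrt_nonneg _) (norm_nonneg _))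
    have h := norm_gradientStep_sub_sq_le hF hL hμ.1 zero_le_one le_rfl x y
    simp only [mul_one] at h
    refine h.trans ?_
    change _ ≤ (q * ‖x - y‖) ^ 2
    rw [mul_pow, hq2]
    gcongr
    exact le_max_left _ _
  refine ⟨hcontr.fixedPoint, ?_, ?_⟩
  · rw [← hcontr.fixedPoint_isFixedPt.eq]
    exact (metricProj_spec hne hcl hcv _).1
  · intro z hz
    set u := hcontr.fixedPoint
    have hu : metricProj C (u - μ • F u) = u := hcontr.fixedPoint_isFixedPt.eq
    have h := metricProj_inner_le_zero hne hcl hcv (u - μ • F u) hz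
    rw [hu, sub_sub_cancel_left, inner_neg_left, real_inner_smul_left] at h
    exact nonneg_of_mul_nonneg_right (by linarith) hμ.1

end VariationalInequality

/-! ### Scalar recursions -/

section Recursion

/-- Above the level `2e/τ` each step lowers `a` by at least `e β n`, whichever size `s n` has; from
below it, one step overshoots by at most `e`. As `∑ β n` diverges, `a` must reach the level, and is
trapped under `2e/τ + e` afterwards. -/
theorem tendsto_zero_of_perturbed_descent {a β δ s : ℕ → ℝ} {τ D : ℝ} (hτ : 0 < τ)
    (ha : ∀ n, 0 ≤ a n) (hβ_pos : ∀ n, 1 ≤ n → 0 < β n) (hβ_lim : Tendsto β atTop (𝓝 0))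
    (hβ_sum : Tendsto (fun N => ∑ n ∈ Finset.Icc 1 N, β n) atTop atTop)
    (hrec : ∀ᶠ n in atTop, a (n + 1) ≤ (1 - τ * β n) * a n + β n * δ n - s n)
    (hs : ∀ n, 0 ≤ s n) (hD : ∀ᶠ n in atTop, δ n ≤ D)
    (hδ : ∀ e > 0, ∃ ρ > 0, ∀ᶠ n in atTop, s n < ρ → δ n ≤ e) :
    Tendsto a atTop (𝓝 0) := by
  have main : ∀ e > 0, ∀ᶠ n in atTop, a n ≤ 2 * e / τ + e := by
    intro e he
    obtain ⟨ρ, hρ, hρδ⟩ := hδ e he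
    -- The bound by `ρ` serves the case `s n ≥ ρ` in `hA`; the bound by `e` limits the overshoot in
    -- `hB`.
    have hβ1 : ∀ᶠ n in atTop, β n * (|D| + e) < min ρ e := by
      have h : Tendsto (fun n => β n * (|D| + e)) atTop (𝓝 0) := by
        simpa using hβ_lim.mul_const (|D| + e)
      exact h.eventually_lt_const (lt_min hρ he)
    obtain ⟨N, hN⟩ := eventually_atTop.1 (((hrec.and hD).and (hρδ.and hβ1)).and
      (eventually_ge_atTop 1))
    have hA : ∀ n ≥ N, 2 * e / τ < a n → a (n + 1) ≤ a n - e * β n := by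
      intro n hn h
      obtain ⟨⟨⟨h1, h2⟩, h3, h4⟩, h5⟩ := hN n hn
      have hb := hβ_pos n h5
      have h6 : 2 * e < a n * τ := (div_lt_iff₀ hτ).1 h
      have h7 : β n * (2 * e) ≤ β n * (a n * τ) := by gcongr
      by_cases hsn : s n < ρ
      · have h8 : β n * δ n ≤ β n * e := by gcongr; exact h3 hsn
        linarith [hs n]
      · have h8 : β n * δ n ≤ β n * |D| := by gcongr; exact h2.trans (le_abs_self D)
        have := min_le_left ρ e
        have := mul_pos hb he
        linarith
    have hB : ∀ n ≥ N, a n ≤ 2 * e / τ → a (n + 1) ≤ 2 * e / τ + e := by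
      intro n hn h
      obtain ⟨⟨⟨h1, h2⟩, h3, h4⟩, h5⟩ := hN n hn
      have hb := hβ_pos n h5
      have h8 : β n * δ n ≤ β n * |D| := by gcongr; exact h2.trans (le_abs_self D)
      have := min_le_right ρ e
      have := mul_pos hb he
      have := mul_nonneg (mul_pos hτ hb).le (ha n)
      linarith [hs n]
    have hex : ∃ n ≥ N, a n ≤ 2 * e / τ := by
      by_contra! hcon
      have hV : ∀ n ≥ N, a (n + 1) + e * ∑ k ∈ Finset.Icc 1 n, β k
          ≤ a (N + 1) + e * ∑ k ∈ Finset.Icc 1 N, β k := by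
        intro n hn
        induction n, hn using Nat.le_induction with
        | base => exact le_rfl
        | succ n hn ih =>
          rw [Finset.sum_Icc_succ_top (by omega)]
          have := hA (n + 1) (by omega) (hcon (n + 1) (by omega))
          linarith
      obtain ⟨n, hn1, hn2⟩ := ((eventually_ge_atTop N).and
        ((hβ_sum.const_mul_atTop he).eventually_gt_atTop
          (a (N + 1) + e * ∑ k ∈ Finset.Icc 1 N, β k))).exists
      linarith [hV n hn1, ha (n + 1)]
    obtain ⟨n₀, hn₀, han₀⟩ := hex
    filter_upwards [eventually_ge_atTop n₀] with n hn
    induction n, hn using Nat.le_induction with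
    | base => linarith
    | succ n hn ih =>
      rcases le_or_gt (a n) (2 * e / τ) with h | h
      · exact hB n (by omega) h
      · have := hA n (by omega) h
        have := mul_pos he (hβ_pos n (hN n (by omega)).2)
        linarith
  refine tendsto_order.2 ⟨fun r hr => Eventually.of_forall fun n => hr.trans_le (ha n), ?_⟩
  intro r hr
  have hc : 0 < 2 / τ + 1 := by positivity
  filter_upwards [main (r / 2 / (2 / τ + 1)) (by positivity)] with n hn
  have e1 : 2 * (r / 2 / (2 / τ + 1)) / τ + r / 2 / (2 / τ + 1) = r / 2 := by
    field_simp
  linarith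

/-- Once `φ ≤ 1/2`, the map `t ↦ M + t/2` keeps `t` below any bound that is at least `2M`. -/
theorem exists_norm_le_of_norm_succ_le {E : Type*} [SeminormedAddGroup E] {d : ℕ → E}
    {φ : ℕ → ℝ} {M : ℝ} (hφ : Tendsto φ atTop (𝓝 0))
    (h : ∀ n, 1 ≤ n → ‖d (n + 1)‖ ≤ M + φ (n + 1) * ‖d n‖) : ∃ R, ∀ n, ‖d n‖ ≤ R := by
  obtain ⟨N, hN⟩ := eventually_atTop.1 ((hφ.eventually_lt_const (u := 1 / 2) (by norm_num)).and
    (eventually_ge_atTop 1))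
  have htail : ∀ n ≥ N, ‖d n‖ ≤ max (2 * M) ‖d N‖ := by
    intro n hn
    induction n, hn using Nat.le_induction with
    | base => exact le_max_right _ _
    | succ n hn ih =>
      have h1 := h n (hN n hn).2
      have h2 : φ (n + 1) * ‖d n‖ ≤ 1 / 2 * ‖d n‖ := by
        gcongr; exact (hN (n + 1) (by omega)).1.le
      linarith [le_max_left (2 * M) ‖d N‖]
  refine ⟨max (2 * M) ‖d N‖ + ∑ k ∈ Finset.range N, ‖d k‖, fun n => ?_⟩
  have hsum : 0 ≤ ∑ k ∈ Finset.range N, ‖d k‖ := Finset.sum_nonneg fun _ _ => norm_nonneg _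
  rcases le_or_gt N n with hn | hn
  · linarith [htail n hn]
  · have := Finset.single_le_sum (f := fun k => ‖d k‖) (fun _ _ => norm_nonneg _)
      (Finset.mem_range.2 hn)
    have h0 : 0 ≤ max (2 * M) ‖d N‖ := (norm_nonneg _).trans (le_max_right _ _)
    linarith

end Recursion

/-! ### Subgradient projections and bounded subdifferentials -/

section SubgradientProjection

variable {H : Type*} [NormedAddCommGroup H] [InnerProductSpace ℝ H]

theorem subgradProj_eq (f : H → ℝ) (g : H → H) (x : H) :
    subgradProj f g x = x - (max (f x) 0 / ‖g x‖ ^ 2) • g x := by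
  unfold subgradProj
  split_ifs with h
  · rw [max_eq_left h.le]
  · rw [max_eq_right (not_lt.1 h)]; simp

theorem norm_subgradProj_sub_self (f : H → ℝ) (g : H → H) (x : H) :
    ‖subgradProj f g x - x‖ = max (f x) 0 / ‖g x‖ := by
  rw [subgradProj_eq, sub_sub_cancel_left, norm_neg, norm_smul, Real.norm_eq_abs,
    abs_of_nonneg (by positivity)]
  rcases eq_or_ne ‖g x‖ 0 with h | h
  · simp [h]
  · field_simp

/-- If `f x > 0`, the image of `x` is its projection onto the half-space where the linearization of
`f` at `x` is nonpositive, which contains `z`. -/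
theorem inner_sub_subgradProj_nonneg {f : H → ℝ} {g : H → H} {x z : H}
    (hg : g x ∈ subdiff f x) (hz : f z ≤ 0) :
    0 ≤ inner ℝ (z - subgradProj f g x) (subgradProj f g x - x) := by
  have h1 : inner ℝ (g x) (z - x) ≤ f z - f x := hg z
  have h2 := norm_subgradProj_sub_self f g x
  have e : inner ℝ (z - subgradProj f g x) (subgradProj f g x - x)
      = inner ℝ (z - x) (subgradProj f g x - x) - ‖subgradProj f g x - x‖ ^ 2 := by
    rw [← real_inner_self_eq_norm_sq, ← inner_sub_left]; congr 1; abel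
  rw [e, h2, subgradProj_eq, sub_sub_cancel_left, inner_neg_right, inner_smul_right,
    real_inner_comm]
  rcases le_or_gt (f x) 0 with hf | hf
  · simp [max_eq_right hf]
  · rw [max_eq_left hf.le]
    have h3 : f x / ‖g x‖ ^ 2 * inner ℝ (g x) (z - x) ≤ f x / ‖g x‖ ^ 2 * (-f x) := by
      gcongr; linarith
    have h4 : (f x / ‖g x‖) ^ 2 = f x / ‖g x‖ ^ 2 * f x := by rw [div_pow]; ring
    linarith

theorem le_norm_subgradProj_sub_self_mul {f : H → ℝ} {g : H → H} {x z : H}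
    (hg : g x ∈ subdiff f x) (hz : f z ≤ 0) :
    f x ≤ ‖subgradProj f g x - x‖ * ‖g x‖ := by
  rw [norm_subgradProj_sub_self]
  rcases eq_or_ne ‖g x‖ 0 with h | h
  -- A zero subgradient makes `x` a minimizer, so `f x ≤ f z ≤ 0`.
  · have h1 : inner ℝ (g x) (z - x) ≤ f z - f x := hg z
    rw [norm_eq_zero.1 h, inner_zero_left] at h1
    simp only [h, mul_zero]; linarith
  · rw [div_mul_cancel₀ _ h]; exact le_max_left _ _

/-- Test the subgradient inequality after a unit step from `x` along `p`: the linear term is exactly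
`‖p‖`. -/
theorem norm_le_of_mem_subdiff {f : H → ℝ} {x p : H} (hp : p ∈ subdiff f x) {B : ℝ} {r : ℝ}
    (hx : ‖x‖ ≤ r) (hB : ∀ z, ‖z‖ ≤ r + 1 → |f z| ≤ B) : ‖p‖ ≤ 2 * B := by
  have hB0 : 0 ≤ B := (abs_nonneg _).trans (hB x (by linarith))
  rcases eq_or_ne ‖p‖ 0 with h | h
  · linarith
  · have h1 : inner ℝ p (x + (‖p‖)⁻¹ • p - x) ≤ f (x + (‖p‖)⁻¹ • p) - f x := hp _
    rw [add_sub_cancel_left, inner_smul_right, real_inner_self_eq_norm_sq, sq,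
      inv_mul_cancel_left₀ h] at h1
    have h2 : ‖x + (‖p‖)⁻¹ • p‖ ≤ r + 1 := by
      refine (norm_add_le _ _).trans ?_
      rw [norm_smul, norm_inv, norm_norm, inv_mul_cancel₀ h]
      linarith
    have h3 := abs_le.1 (hB _ h2)
    have h4 := abs_le.1 (hB x (by linarith))
    linarith

theorem LipschitzOnBounded.boundedOnBounded {E : Type*} [NormedAddCommGroup E] {f : E → ℝ}
    (hf : LipschitzOnBounded f) :
    BoundedOnBounded f := by
  intro B hB
  obtain ⟨L, hL⟩ := hf B hB
  rw [Metric.isBounded_iff] at hB ⊢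
  obtain ⟨R, hR⟩ := hB
  refine ⟨L * R, ?_⟩
  rintro _ ⟨a, ha, rfl⟩ _ ⟨b, hb, rfl⟩
  exact (hL.dist_le_mul a ha b hb).trans (by gcongr; exact hR ha hb)

theorem BoundedOnBounded.subdiffBoundedOnBounded {f : H → ℝ} (hf : BoundedOnBounded f) :
    SubdiffBoundedOnBounded f := by
  intro B hB
  obtain ⟨r, hr⟩ := hB.exists_norm_le
  obtain ⟨b, hb⟩ := (hf (Metric.closedBall 0 (r + 1)) Metric.isBounded_closedBall).exists_norm_le
  refine isBounded_iff_forall_norm_le.2 ⟨2 * b, fun p hp => ?_⟩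
  obtain ⟨x, hx, hpx⟩ := Set.mem_iUnion₂.1 hp
  exact norm_le_of_mem_subdiff hpx (hr x hx) fun z hz =>
    hb _ ⟨z, mem_closedBall_zero_iff.2 hz, rfl⟩

theorem exists_norm_subgradient_le {N : ℕ} {c : ℕ → H → ℝ} {g : ℕ → H → H}
    (hg : ∀ i ∈ Finset.Icc 1 N, ∀ z : H, g i z ∈ subdiff (c i) z)
    (hb : ∀ i ∈ Finset.Icc 1 N, SubdiffBoundedOnBounded (c i)) (r : ℝ) :
    ∃ M, 0 ≤ M ∧ ∀ i ∈ Finset.Icc 1 N, ∀ z, ‖z‖ ≤ r → ‖g i z‖ ≤ M := by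
  have h : ∀ i, ∃ M, 0 ≤ M ∧ (i ∈ Finset.Icc 1 N → ∀ z, ‖z‖ ≤ r → ‖g i z‖ ≤ M) := by
    intro i
    by_cases hi : i ∈ Finset.Icc 1 N
    · obtain ⟨M, hM⟩ := (hb i hi (Metric.closedBall 0 r)
        Metric.isBounded_closedBall).exists_norm_le
      refine ⟨max M 0, le_max_right _ _, fun _ z hz => le_max_of_le_left (hM _ ?_)⟩
      exact Set.mem_iUnion₂.2 ⟨z, mem_closedBall_zero_iff.2 hz, hg i hi z⟩
    · exact ⟨0, le_rfl, fun h => absurd h hi⟩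
  choose M hM0 hM using h
  refine ⟨∑ i ∈ Finset.Icc 1 N, M i, Finset.sum_nonneg fun i _ => hM0 i, fun i hi z hz => ?_⟩
  exact (hM i hi z hz).trans (Finset.single_le_sum (fun j _ => hM0 j) hi)

end SubgradientProjection

/-! ### The constraint set and almost feasible points -/

section ConstraintSet

variable {H : Type*} [NormedAddCommGroup H] [InnerProductSpace ℝ H]

theorem mem_constraintSet {E : Type*} {m : ℕ} {c : ℕ → E → ℝ} {K : Set E} {z : E} :
    z ∈ constraintSet m c K ↔ (∀ i ∈ Finset.Icc 1 (m - 1), c i z ≤ 0) ∧ z ∈ K := by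
  simp only [constraintSet, Set.mem_inter_iff, Set.mem_iInter, Set.mem_ofPred_eq]

theorem isClosed_constraintSet {E : Type*} [NormedAddCommGroup E] {m : ℕ} {c : ℕ → E → ℝ}
    {K : Set E}
    (hc : ∀ i ∈ Finset.Icc 1 (m - 1), Continuous (c i)) (hK : IsClosed K) :
    IsClosed (constraintSet m c K) :=
  (isClosed_biInter fun i hi => isClosed_le (hc i hi) continuous_const).inter hK

theorem convex_constraintSet {m : ℕ} {c : ℕ → H → ℝ} {K : Set H}
    (hc : ∀ i ∈ Finset.Icc 1 (m - 1), ConvexOn ℝ Set.univ (c i)) (hK : Convex ℝ K) :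
    Convex ℝ (constraintSet m c K) :=
  (convex_iInter₂ fun i hi => by simpa using (hc i hi).convex_le 0).inter hK

/-- This plays the role of weak compactness. Were it false for each `ρ = 1 / (k + 1)`, the sets `Q
k` of violating points would be nonempty, nested, closed, convex and bounded; a common point would
be feasible and contradict `hu`. -/
theorem exists_neg_le_inner_of_almost_feasible [CompleteSpace H] {m : ℕ} {c : ℕ → H → ℝ}
    {K : Set H} (hcont : ∀ i ∈ Finset.Icc 1 (m - 1), Continuous (c i))
    (hconv : ∀ i ∈ Finset.Icc 1 (m - 1), ConvexOn ℝ Set.univ (c i))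
    (hKcl : IsClosed K) (hKcv : Convex ℝ K) (hKb : Bornology.IsBounded K) {v u : H}
    (hu : ∀ z ∈ constraintSet m c K, 0 ≤ inner ℝ v (z - u)) {e : ℝ} (he : 0 < e) :
    ∃ ρ > 0, ∀ x ∈ K, (∀ i ∈ Finset.Icc 1 (m - 1), c i x ≤ ρ) → -e ≤ inner ℝ v (x - u) := by
  set Q : ℕ → Set H := fun k => constraintSet m (fun i x => c i x - 1 / (k + 1 : ℝ)) K ∩
    {x | inner ℝ v x ≤ inner ℝ v u - e}
  have hQ : Antitone Q := by
    intro k l hkl x hx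
    refine ⟨mem_constraintSet.2 ⟨fun i hi => ?_, (mem_constraintSet.1 hx.1).2⟩, hx.2⟩
    have h1 := (mem_constraintSet.1 hx.1).1 i hi
    have h2 : 1 / (l + 1 : ℝ) ≤ 1 / (k + 1) := by
      exact one_div_le_one_div_of_le (by positivity) (by exact_mod_cast Nat.succ_le_succ hkl)
    linarith
  by_contra! hcon
  have hne : ∀ k, (Q k).Nonempty := by
    intro k
    obtain ⟨x, hxK, hxc, hx⟩ := hcon (1 / (k + 1)) (by positivity)
    refine ⟨x, mem_constraintSet.2 ⟨fun i hi => by linarith [hxc i hi], hxK⟩, ?_⟩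
    rw [inner_sub_right] at hx
    change inner ℝ v x ≤ inner ℝ v u - e
    linarith
  have hcl : ∀ k, IsClosed (Q k) := fun k =>
    (isClosed_constraintSet (fun i hi => (hcont i hi).sub continuous_const) hKcl).inter
      (isClosed_le (by fun_prop) continuous_const)
  have hcv : ∀ k, Convex ℝ (Q k) := by
    intro k
    refine (convex_constraintSet (fun i hi => ?_) hKcv).inter ?_
    · refine ((hconv i hi).add_const (-(1 / (k + 1 : ℝ)))).congr fun x _ => ?_
      simp [sub_eq_add_neg]
    · exact convex_halfSpace_le (innerSL ℝ v).toLinearMap.isLinear _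
  obtain ⟨w, hw⟩ := nonempty_iInter_of_antitone_closed_convex hQ hne hcl hcv
    (hKb.subset fun x hx => (mem_constraintSet.1 hx.1).2)
  rw [Set.mem_iInter] at hw
  have hwC : w ∈ constraintSet m c K := by
    refine mem_constraintSet.2 ⟨fun i hi => ?_, (mem_constraintSet.1 (hw 0).1).2⟩
    refine ge_of_tendsto' (tendsto_one_div_add_atTop_nhds_zero_nat (𝕜 := ℝ)) fun k => ?_
    have := (mem_constraintSet.1 (hw k).1).1 i hi
    linarith
  have h1 := hu w hwC
  have h2 : inner ℝ v w ≤ inner ℝ v u - e := (hw 0).2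
  rw [inner_sub_right] at h1
  linarith

end ConstraintSet

/-! ### The extrapolated cyclic operator -/

section CyclicOperator

variable {H : Type*} [NormedAddCommGroup H] [InnerProductSpace ℝ H]

/-- The sum of the squared lengths of the successive displacements from `y` to `cyclicOp`. -/
noncomputable def sumSqDisp (m : ℕ) (c : ℕ → H → ℝ) (g : ℕ → H → H) (K : Set H) (y : H) : ℝ :=
  ‖cyclicOp m c g K y - subgradChain c g y (m - 1)‖ ^ 2 +
    ∑ i ∈ Finset.range (m - 1), ‖subgradChain c g y (i + 1) - subgradChain c g y i‖ ^ 2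

theorem sumSqDisp_nonneg (m : ℕ) (c : ℕ → H → ℝ) (g : ℕ → H → H) (K : Set H) (y : H) :
    0 ≤ sumSqDisp m c g K y := by
  unfold sumSqDisp; positivity

theorem sum_Icc_one_eq_sum_range (f : ℕ → ℝ) (N : ℕ) :
    ∑ i ∈ Finset.Icc 1 N, f i = ∑ i ∈ Finset.range N, f (i + 1) := by
  induction N with
  | zero => simp
  | succ N ih => rw [Finset.sum_Icc_succ_top (by omega), ih, Finset.sum_range_succ]

/-- The numerator of the extrapolation step size. -/
noncomputable def extrapolationNum (m : ℕ) (c : ℕ → H → ℝ) (g : ℕ → H → H) (K : Set H) (y : H) : ℝ :=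
  inner ℝ (cyclicOp m c g K y - y) (cyclicOp m c g K y - subgradChain c g y (m - 1)) +
    ∑ i ∈ Finset.range (m - 1), inner ℝ (subgradChain c g y (i + 1) - y)
      (subgradChain c g y (i + 1) - subgradChain c g y i)

theorem stepSize_of_notMem {m : ℕ} {c : ℕ → H → ℝ} {g : ℕ → H → H} {K : Set H} {y : H}
    (hy : y ∉ constraintSet m c K) :
    stepSize m c g K y = extrapolationNum m c g K y / ‖cyclicOp m c g K y - y‖ ^ 2 := by
  unfold stepSize extrapolationNum
  simp only [hy, if_false]
  congr 1
  rw [sub_add, sub_eq_add_neg, neg_sub, ← Finset.sum_sub_distrib, sum_Icc_one_eq_sum_range]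
  congr 1
  refine Finset.sum_congr rfl fun i _ => ?_
  simp only [Nat.add_sub_cancel]
  set u := subgradChain c g y i
  have hu : subgradChain c g y (i + 1) = subgradProj (c (i + 1)) (g (i + 1)) u := rfl
  rw [hu, ← norm_subgradProj_sub_self, ← real_inner_self_eq_norm_sq]
  set w := subgradProj (c (i + 1)) (g (i + 1)) u with hw
  -- Splitting at `u` recovers the squared quotient from `w - u` and the subgradient term from `u -
  -- y`.
  have e : w - y = (w - u) + (u - y) := by abel
  rw [e, inner_add_left, sub_eq_add_neg]
  congr 1
  rw [hw, subgradProj_eq, sub_sub_cancel_left, inner_neg_right, inner_smul_right]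

/-- By polarization each summand is a difference of squared distances to `y` plus a squared
displacement; the differences telescope along the chain from `u₀ = y`. -/
theorem two_mul_extrapolationNum (m : ℕ) (c : ℕ → H → ℝ) (g : ℕ → H → H) (K : Set H) (y : H) :
    2 * extrapolationNum m c g K y = ‖cyclicOp m c g K y - y‖ ^ 2 + sumSqDisp m c g K y := by
  have key : ∀ p q : H, 2 * inner ℝ (p - y) (p - q)
      = ‖p - y‖ ^ 2 - ‖q - y‖ ^ 2 + ‖p - q‖ ^ 2 := by
    intro p q
    have e : q - y = (p - y) - (p - q) := by abel
    rw [e, norm_sub_sq_real (p - y)]; ring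
  unfold extrapolationNum sumSqDisp
  rw [mul_add, key, Finset.mul_sum, Finset.sum_congr rfl fun i _ => key _ _,
    Finset.sum_add_distrib, Finset.sum_range_sub (fun i => ‖subgradChain c g y i - y‖ ^ 2)]
  simp only [subgradChain, sub_self, norm_zero]
  ring

/-- Every step `r ↦ q` of the chain makes an obtuse angle with feasible points, so `y` may be tested
against `z` in place of `q`; the displacements sum to `T y - y`. -/
theorem extrapolationNum_le_inner [CompleteSpace H] {m : ℕ} {c : ℕ → H → ℝ} {g : ℕ → H → H}
    {K : Set H} (hg : ∀ i ∈ Finset.Icc 1 (m - 1), ∀ z : H, g i z ∈ subdiff (c i) z)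
    (hcl : IsClosed K) (hcv : Convex ℝ K) (y : H) {z : H} (hz : z ∈ constraintSet m c K) :
    extrapolationNum m c g K y ≤ inner ℝ (z - y) (cyclicOp m c g K y - y) := by
  obtain ⟨hzc, hzK⟩ := mem_constraintSet.1 hz
  set u := subgradChain c g y
  set p := cyclicOp m c g K y
  have e : p - y = (p - u (m - 1)) + ∑ i ∈ Finset.range (m - 1), (u (i + 1) - u i) := by
    rw [Finset.sum_range_sub]; simp [u, subgradChain]
  have hstep : ∀ q r : H, 0 ≤ inner ℝ (z - q) (q - r) →
      inner ℝ (q - y) (q - r) ≤ inner ℝ (z - y) (q - r) := by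
    intro q r h
    have e : z - y = (z - q) + (q - y) := by abel
    rw [e, inner_add_left]; linarith
  rw [e, inner_add_right, inner_sum, extrapolationNum]
  refine add_le_add (hstep _ _ ?_) (Finset.sum_le_sum fun i hi => hstep _ _ ?_)
  · have h := metricProj_inner_le_zero ⟨z, hzK⟩ hcl hcv (u (m - 1)) hzK
    change inner ℝ (u (m - 1) - p) (z - p) ≤ 0 at h
    rw [real_inner_comm, ← neg_sub p (u (m - 1)), inner_neg_right] at h
    linarith
  · have hi' : i + 1 ∈ Finset.Icc 1 (m - 1) := by
      rw [Finset.mem_range] at hi; rw [Finset.mem_Icc]; omega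
    exact inner_sub_subgradProj_nonneg (hg _ hi' _) (hzc _ hi')

theorem cyclicOp_sub_eq_zero_and_sumSqDisp [CompleteSpace H] {m : ℕ} {c : ℕ → H → ℝ}
    {g : ℕ → H → H} {K : Set H} (hcl : IsClosed K) (hcv : Convex ℝ K) {y : H}
    (hy : y ∈ constraintSet m c K) :
    cyclicOp m c g K y = y ∧ sumSqDisp m c g K y = 0 := by
  obtain ⟨hyc, hyK⟩ := mem_constraintSet.1 hy
  have hch : ∀ i, i ≤ m - 1 → subgradChain c g y i = y := by
    intro i
    induction i with
    | zero => intro _; rfl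
    | succ i ih =>
      intro hi
      have h := hyc (i + 1) (Finset.mem_Icc.2 ⟨by omega, hi⟩)
      rw [subgradChain, ih (by omega), subgradProj_eq, max_eq_right h]
      simp
  have hT : cyclicOp m c g K y = y := by
    rw [cyclicOp, hch _ le_rfl, metricProj_eq_self ⟨y, hyK⟩ hcl hcv hyK]
  refine ⟨hT, ?_⟩
  rw [sumSqDisp, hT, hch _ le_rfl, Finset.sum_eq_zero]
  · simp
  · intro i hi
    rw [Finset.mem_range] at hi
    rw [hch _ (by omega), hch _ (by omega)]; simp

/-- Write `t = ‖T y - y‖ ^ 2` and `2N = t + S`. The step gains at least `l (2 - l) N² / t`, where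
`N² ≥ t S` by the arithmetic-geometric mean inequality and `l (2 - l) ≥ ε²`. -/
theorem norm_extrapolated_sub_sq_le [CompleteSpace H] {m : ℕ} {c : ℕ → H → ℝ} {g : ℕ → H → H}
    {K : Set H} (hg : ∀ i ∈ Finset.Icc 1 (m - 1), ∀ z : H, g i z ∈ subdiff (c i) z)
    (hcl : IsClosed K) (hcv : Convex ℝ K) (y : H) {z : H} (hz : z ∈ constraintSet m c K)
    {ε l : ℝ} (hε : 0 < ε) (hl : l ∈ Set.Icc ε (2 - ε)) :
    ‖y + (l * stepSize m c g K y) • (cyclicOp m c g K y - y) - z‖ ^ 2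
      ≤ ‖y - z‖ ^ 2 - ε ^ 2 * sumSqDisp m c g K y := by
  by_cases hy : y ∈ constraintSet m c K
  · obtain ⟨h1, h2⟩ := cyclicOp_sub_eq_zero_and_sumSqDisp (g := g) hcl hcv hy
    simp [h1, h2]
  have hN := two_mul_extrapolationNum m c g K y
  have hin := extrapolationNum_le_inner hg hcl hcv y hz
  have hS := sumSqDisp_nonneg m c g K y
  rw [stepSize_of_notMem hy]
  set p := cyclicOp m c g K y
  set S := sumSqDisp m c g K y
  set N := extrapolationNum m c g K y
  rcases eq_or_ne (p - y) 0 with h0 | h0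
  -- A fixed point of `T` has `N ≤ 0` and `2N = S ≥ 0`, so there is nothing to gain.
  · rw [h0, inner_zero_right] at hin
    rw [h0, norm_zero] at hN
    have : S = 0 := by linarith
    simp [h0, this]
  have ht : 0 < ‖p - y‖ ^ 2 := by positivity
  set t := ‖p - y‖ ^ 2 with ht_def
  have e : y + (l * (N / t)) • (p - y) - z = (l * (N / t)) • (p - y) - (z - y) := by abel
  rw [e, norm_sub_sq_real, norm_smul, mul_pow, Real.norm_eq_abs, sq_abs, real_inner_smul_left,
    real_inner_comm, ← ht_def, norm_sub_rev z y]
  have hN0 : 0 < N := by linarith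
  have hl0 : 0 < l := hε.trans_le hl.1
  have h1 : l * (N / t) * N ≤ l * (N / t) * inner ℝ (z - y) (p - y) := by gcongr
  have h2 : (l * (N / t)) ^ 2 * t = l ^ 2 * (N ^ 2 / t) := by field_simp
  have h3 : l * (N / t) * N = l * (N ^ 2 / t) := by ring
  have h4 : S ≤ N ^ 2 / t := by
    rw [le_div_iff₀ ht]; nlinarith [sq_nonneg (t - S)]
  have h5 : ε ^ 2 ≤ l * (2 - l) := by nlinarith [hl.1, hl.2]
  have h6 : ε ^ 2 * S ≤ l * (2 - l) * (N ^ 2 / t) :=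
    mul_le_mul h5 h4 hS ((sq_nonneg ε).trans h5)
  rw [h2]
  linarith

theorem norm_subgradChain_sub_le {m : ℕ} {c : ℕ → H → ℝ} {g : ℕ → H → H} {y : H} {r : ℝ}
    (h : ∀ i < m - 1, ‖subgradChain c g y (i + 1) - subgradChain c g y i‖ ≤ r) :
    ∀ i ≤ m - 1, ‖subgradChain c g y i - y‖ ≤ i * r := by
  intro i
  induction i with
  | zero => intro _; simp [subgradChain]
  | succ i ih =>
    intro hi
    have h1 := ih (by omega)
    have h2 := h i (by omega)
    have h3 := norm_sub_le_norm_sub_add_norm_sub (subgradChain c g y (i + 1))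
      (subgradChain c g y i) y
    push_cast
    linarith

theorem norm_displacement_le_of_sumSqDisp_le {m : ℕ} {c : ℕ → H → ℝ} {g : ℕ → H → H} {K : Set H}
    {y : H} {r : ℝ} (hr : 0 ≤ r) (h : sumSqDisp m c g K y ≤ r ^ 2) :
    ∀ i < m - 1, ‖subgradChain c g y (i + 1) - subgradChain c g y i‖ ≤ r := by
  intro i hi
  refine le_of_sq_le_sq ?_ hr
  have h1 := Finset.single_le_sum
    (f := fun j => ‖subgradChain c g y (j + 1) - subgradChain c g y j‖ ^ 2)
    (fun _ _ => sq_nonneg _) (Finset.mem_range.2 hi)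
  have h2 := sq_nonneg ‖cyclicOp m c g K y - subgradChain c g y (m - 1)‖
  unfold sumSqDisp at h
  linarith

/-- If all displacements of the chain starting at `y` are small and `x` is close to `y`, then `x`
is almost feasible. -/
theorem constraint_le_of_small_displacement {m : ℕ} {c : ℕ → H → ℝ} {g : ℕ → H → H}
    (hg : ∀ i ∈ Finset.Icc 1 (m - 1), ∀ z : H, g i z ∈ subdiff (c i) z)
    {z : H} (hz : ∀ i ∈ Finset.Icc 1 (m - 1), c i z ≤ 0) {R M r : ℝ} (hM : 0 ≤ M)
    (hgM : ∀ i ∈ Finset.Icc 1 (m - 1), ∀ w, ‖w‖ ≤ R + m + 1 → ‖g i w‖ ≤ M)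
    (hr1 : r ≤ 1) {x y : H} (hx : ‖x‖ ≤ R) (hxy : ‖y - x‖ ≤ r)
    (h : ∀ i < m - 1, ‖subgradChain c g y (i + 1) - subgradChain c g y i‖ ≤ r) :
    ∀ i ∈ Finset.Icc 1 (m - 1), c i x ≤ (m + 2) * M * r := by
  have hr0 : 0 ≤ r := (norm_nonneg _).trans hxy
  intro i hi
  obtain ⟨j, rfl⟩ : ∃ j, i = j + 1 := ⟨i - 1, by have := (Finset.mem_Icc.1 hi).1; omega⟩
  have hj : j < m - 1 := by have := (Finset.mem_Icc.1 hi).2; omega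
  set u := subgradChain c g y j with hu
  have hjm : (j : ℝ) ≤ m := by exact_mod_cast (by omega : j ≤ m)
  have h1 : ‖u - y‖ ≤ m * r :=
    (norm_subgradChain_sub_le h j hj.le).trans (by gcongr)
  have h2 : ‖u - x‖ ≤ (m + 1) * r := by
    have := norm_sub_le_norm_sub_add_norm_sub u y x
    linarith
  have h3 : ‖u‖ ≤ R + m + 1 := by
    have h4 := norm_le_norm_sub_add u x
    have h5 : (m + 1 : ℝ) * r ≤ (m + 1) * 1 := by gcongr
    linarith
  have h4 : c (j + 1) u ≤ r * M := by
    refine (le_norm_subgradProj_sub_self_mul (hg _ hi u) (hz _ hi)).trans ?_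
    exact mul_le_mul (h j hj) (hgM _ hi u h3) (norm_nonneg _) hr0
  -- Using the subgradient at `x` bounds `c x` by `c u ≤ M r` plus `M ‖u - x‖ ≤ M (m + 1) r`.
  have h5 : inner ℝ (g (j + 1) x) (u - x) ≤ c (j + 1) u - c (j + 1) x := hg _ hi x u
  have h6 : -(M * ((m + 1) * r)) ≤ inner ℝ (g (j + 1) x) (u - x) := by
    have h7 := (abs_le.1 (abs_real_inner_le_norm (g (j + 1) x) (u - x))).1
    have h8 : ‖g (j + 1) x‖ * ‖u - x‖ ≤ M * ((m + 1) * r) :=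
      mul_le_mul (hgM _ hi x (by have : (0 : ℝ) ≤ m := m.cast_nonneg; linarith)) h2
        (norm_nonneg _) hM
    linarith
  linarith

end CyclicOperator

/-! ### Strong convergence of the method -/

section Convergence

variable {H : Type*} [NormedAddCommGroup H] [InnerProductSpace ℝ H]

theorem norm_sq_le_norm_sub_sq_add (p w : H) : ‖p‖ ^ 2 ≤ ‖p - w‖ ^ 2 + 2 * inner ℝ p w := by
  rw [norm_sub_sq_real]; linarith [sq_nonneg ‖w‖]

theorem LipschitzOp.norm_le {E : Type*} [NormedAddCommGroup E] {F : E → E} {κ : ℝ}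
    (hL : LipschitzOp κ F) (x u : E) :
    ‖F x‖ ≤ ‖F u‖ + κ * ‖x - u‖ := by
  linarith [norm_le_norm_add_norm_sub' (F x) (F u), hL.2 x u]

/-- One step of the conjugate gradient direction, in the form of an inexact descent step. -/
theorem norm_conjugateStep_sub_sq_le {F : H → H} {η κ μ b : ℝ} (hF : StronglyMonotoneOp η F)
    (hL : LipschitzOp κ F) (hμ : 0 < μ) (hb0 : 0 ≤ b) (hb1 : b ≤ 1) (x u d : H) (t : ℝ) :
    ‖x + (μ * b) • (-F x + t • d) - u‖ ^ 2
      ≤ (1 - μ * (2 * η - μ * κ ^ 2) * b) * ‖x - u‖ ^ 2 + b * (2 * μ *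
        (t * inner ℝ (x + (μ * b) • (-F x + t • d) - u) d
          - inner ℝ (F u) (x + (μ * b) • (-F x + t • d) - u))) := by
  have h1 := norm_gradientStep_sub_sq_le hF hL hμ hb0 hb1 x u
  set p := x + (μ * b) • (-F x + t • d) - u with hp
  -- Subtracting this vector from `p` leaves the difference of the pure gradient steps at `x` and
  -- `u`.
  have h2 := norm_sq_le_norm_sub_sq_add p ((μ * b) • (t • d - F u))
  have e : p - (μ * b) • (t • d - F u) = (x - (μ * b) • F x) - (u - (μ * b) • F u) := by
    rw [hp]; module
  rw [e, inner_smul_right, inner_sub_right, inner_smul_right, real_inner_comm (F u) p] at h2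
  rw [real_inner_comm p (F u)] at *
  linarith

end Convergence

theorem corollary1 {H : Type*} [NormedAddCommGroup H] [InnerProductSpace ℝ H] [CompleteSpace H]
    (m : ℕ) (hm : 1 ≤ m)
    (F : H → H) (η κ : ℝ) (hFmono : StronglyMonotoneOp η F) (hFlip : LipschitzOp κ F)
    (c : ℕ → H → ℝ) (g : ℕ → H → H)
    (hc_cont : ∀ i ∈ Finset.Icc 1 (m - 1), Continuous (c i))
    (hc_conv : ∀ i ∈ Finset.Icc 1 (m - 1), ConvexOn ℝ Set.univ (c i))
    (hg : ∀ i ∈ Finset.Icc 1 (m - 1), ∀ z : H, g i z ∈ subdiff (c i) z)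
    (Cm : Set H) (hCm_closed : IsClosed Cm) (hCm_conv : Convex ℝ Cm)
    (hCm_bdd : Bornology.IsBounded Cm)
    (hC_ne : (constraintSet m c Cm).Nonempty)
    (μ : ℝ) (hμ : μ ∈ Set.Ioo 0 (2 * η / κ ^ 2))
    (β φ lam : ℕ → ℝ)
    (hβ_mem : ∀ n, 1 ≤ n → β n ∈ Set.Ioc 0 1)
    (hφ_nonneg : ∀ n, 1 ≤ n → 0 ≤ φ n)
    (hβ_lim : Tendsto β atTop (𝓝 0))
    (hβ_sum : Tendsto (fun N => ∑ n ∈ Finset.Icc 1 N, β n) atTop atTop)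
    (hφ_lim : Tendsto φ atTop (𝓝 0))
    (ε : ℝ) (hε : ε ∈ Set.Ioo 0 1)
    (hlam : ∀ n, 1 ≤ n → lam n ∈ Set.Icc ε (2 - ε))
    (hbdd : (∀ i ∈ Finset.Icc 1 (m - 1), LipschitzOnBounded (c i)) ∨
      (∀ i ∈ Finset.Icc 1 (m - 1), BoundedOnBounded (c i)) ∨
      (∀ i ∈ Finset.Icc 1 (m - 1), SubdiffBoundedOnBounded (c i)))
    (x y d : ℕ → H) (hx : IsESCoMCGD m F c g Cm μ β φ lam x y d) :
    ∃ u : H, IsVIPSolution F (constraintSet m c Cm) u ∧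
      (∀ v : H, IsVIPSolution F (constraintSet m c Cm) v → v = u) ∧
      Tendsto x atTop (𝓝 u) := by
  have hg_bdd : ∀ i ∈ Finset.Icc 1 (m - 1), SubdiffBoundedOnBounded (c i) := by
    rcases hbdd with h | h | h
    · exact fun i hi => (h i hi).boundedOnBounded.subdiffBoundedOnBounded
    · exact fun i hi => (h i hi).subdiffBoundedOnBounded
    · exact h
  obtain ⟨u, hu⟩ := exists_isVIPSolution hFmono hFlip hμ hC_ne
    (isClosed_constraintSet hc_cont hCm_closed) (convex_constraintSet hc_conv hCm_conv)
  refine ⟨u, hu, fun v hv => hu.eq hFmono hv, ?_⟩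
  have hτ := relaxation_modulus_pos hFlip.1 hμ
  obtain ⟨huc, huK⟩ := mem_constraintSet.1 hu.1
  have hμ0 : 0 < μ := hμ.1
  obtain ⟨R, hR⟩ := hCm_bdd.exists_norm_le
  have hR0 : 0 ≤ R := (norm_nonneg u).trans (hR u huK)
  have hxK : ∀ n, 1 ≤ n → x n ∈ Cm := by
    intro n hn
    induction n, hn using Nat.le_induction with
    | base => exact hx.x_one
    | succ n hn _ =>
      rw [hx.x_succ n hn]
      exact (metricProj_spec ⟨u, huK⟩ hCm_closed hCm_conv _).1
  have hxu : ∀ n, 1 ≤ n → ‖x n - u‖ ≤ 2 * R := fun n hn => by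
    linarith [norm_sub_le (x n) u, hR _ (hxK n hn), hR u huK]
  obtain ⟨B, hB⟩ : ∃ B, ∀ n, ‖d n‖ ≤ B := by
    refine exists_norm_le_of_norm_succ_le (M := ‖F u‖ + κ * (2 * R)) hφ_lim fun n hn => ?_
    rw [hx.d_succ n hn]
    refine (norm_add_le _ _).trans ?_
    rw [norm_neg, norm_smul, Real.norm_of_nonneg (hφ_nonneg _ (by omega))]
    have h1 := hFlip.norm_le (x (n + 1)) u
    have h2 := mul_le_mul_of_nonneg_left (hxu (n + 1) (by omega)) hFlip.1.le
    linarith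
  have hB0 : 0 ≤ B := (norm_nonneg _).trans (hB 0)
  have hyx : ∀ n, 1 ≤ n → ‖y n - x n‖ ≤ μ * B * β n := by
    intro n hn
    have hb := (hβ_mem n hn).1
    rw [hx.y_eq n hn, add_sub_cancel_left, norm_smul, Real.norm_of_nonneg (by positivity)]
    calc μ * β n * ‖d n‖ ≤ μ * β n * B := by gcongr; exact hB n
      _ = μ * B * β n := by ring
  have hyu : ∀ n, 1 ≤ n → ‖y n - u‖ ≤ μ * B + 2 * R := by
    intro n hn
    have h1 : μ * B * β n ≤ μ * B * 1 := by gcongr; exact (hβ_mem n hn).2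
    linarith [norm_sub_le_norm_sub_add_norm_sub (y n) (x n) u, hyx n hn, hxu n hn]
  have hφd : ∀ n, 1 ≤ n → φ n * inner ℝ (y n - u) (d (n - 1)) ≤ (μ * B + 2 * R) * B * φ n := by
    intro n hn
    have h1 : inner ℝ (y n - u) (d (n - 1)) ≤ (μ * B + 2 * R) * B :=
      (real_inner_le_norm _ _).trans
        (mul_le_mul (hyu n hn) (hB _) (norm_nonneg _) (by positivity))
    have := mul_le_mul_of_nonneg_left h1 (hφ_nonneg n hn)
    linarith
  have hyx_lim : Tendsto (fun n => μ * B * β n) atTop (𝓝 0) := by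
    simpa using hβ_lim.const_mul (μ * B)
  have hFin : ∀ p : H, -inner ℝ (F u) p ≤ ‖F u‖ * ‖p‖ := fun p => by
    linarith [neg_abs_le (inner ℝ (F u) p), abs_real_inner_le_norm (F u) p]
  have hlim : Tendsto (fun n => ‖x n - u‖ ^ 2) atTop (𝓝 0) := by
    refine tendsto_zero_of_perturbed_descent (β := β)
      (δ := fun n => 2 * μ * (φ n * inner ℝ (y n - u) (d (n - 1)) - inner ℝ (F u) (y n - u)))
      (s := fun n => ε ^ 2 * sumSqDisp m c g Cm (y n))
      (D := 2 * μ * ((μ * B + 2 * R) * B + ‖F u‖ * (μ * B + 2 * R))) hτ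
      (fun n => sq_nonneg _) (fun n hn => (hβ_mem n hn).1) hβ_lim hβ_sum ?_
      (fun n => mul_nonneg (sq_nonneg ε) (sumSqDisp_nonneg m c g Cm (y n))) ?_ ?_
    -- The recursion for `d n` starts at `n = 2`; `d 0` is arbitrary.
    · filter_upwards [eventually_ge_atTop 2] with n hn
      have hn1 : 1 ≤ n := by omega
      have h1 : ‖x (n + 1) - u‖ ^ 2 ≤ ‖y n - u‖ ^ 2 - ε ^ 2 * sumSqDisp m c g Cm (y n) := by
        refine le_trans ?_ (norm_extrapolated_sub_sq_le hg hCm_closed hCm_conv (y n) hu.1 hε.1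
          (hlam n hn1))
        rw [hx.x_succ n hn1]
        nth_rewrite 1 [← metricProj_eq_self ⟨u, huK⟩ hCm_closed hCm_conv huK]
        exact pow_le_pow_left₀ (norm_nonneg _)
          (norm_metricProj_sub_metricProj_le ⟨u, huK⟩ hCm_closed hCm_conv _ _) 2
      have h2 := norm_conjugateStep_sub_sq_le hFmono hFlip hμ0 (hβ_mem n hn1).1.le
        (hβ_mem n hn1).2 (x n) u (d (n - 1)) (φ n)
      have hd : d n = -F (x n) + φ n • d (n - 1) := by
        have := hx.d_succ (n - 1) (by omega)
        rwa [Nat.sub_add_cancel hn1] at this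
      rw [← hd, ← hx.y_eq n hn1] at h2
      linarith
    · filter_upwards [eventually_ge_atTop 1, hφ_lim.eventually_lt_const zero_lt_one] with n hn hφ1
      have h1 := hφd n hn
      have h2 : (μ * B + 2 * R) * B * φ n ≤ (μ * B + 2 * R) * B * 1 := by gcongr
      have h3 := hFin (y n - u)
      have h4 : ‖F u‖ * ‖y n - u‖ ≤ ‖F u‖ * (μ * B + 2 * R) := by gcongr; exact hyu n hn
      gcongr
      linarith
    · intro e he
      -- The tolerance `e / (4μ)` costs `e / 2` after multiplication by `2μ`; `herr` supplies the
      -- other half.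
      obtain ⟨ρ, hρ, hρu⟩ := exists_neg_le_inner_of_almost_feasible hc_cont hc_conv hCm_closed
        hCm_conv hCm_bdd hu.2 (show 0 < e / (4 * μ) by positivity)
      obtain ⟨M, hM, hgM⟩ := exists_norm_subgradient_le hg hg_bdd (R + m + 1)
      obtain ⟨r, hr0, hr1, hr⟩ : ∃ r : ℝ, 0 < r ∧ r ≤ 1 ∧ (m + 2) * M * r ≤ ρ := by
        have hA : 0 ≤ (m + 2 : ℝ) * M := by positivity
        refine ⟨min 1 (ρ / ((m + 2) * M + 1)), lt_min one_pos (by positivity),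
          min_le_left _ _, ?_⟩
        calc (m + 2) * M * min 1 (ρ / ((m + 2) * M + 1))
            ≤ ((m + 2) * M + 1) * (ρ / ((m + 2) * M + 1)) := by
              gcongr
              · linarith
              · exact min_le_right _ _
          _ = ρ := mul_div_cancel₀ _ (by positivity)
      have herr : ∀ᶠ n in atTop,
          2 * μ * ((μ * B + 2 * R) * B * φ n + ‖F u‖ * (μ * B * β n)) < e / 2 := by
        have h : Tendsto (fun n => 2 * μ * ((μ * B + 2 * R) * B * φ n + ‖F u‖ * (μ * B * β n)))
            atTop (𝓝 0) := by
          simpa using ((hφ_lim.const_mul ((μ * B + 2 * R) * B)).add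
            (hyx_lim.const_mul ‖F u‖)).const_mul (2 * μ)
        exact h.eventually_lt_const (by positivity)
      refine ⟨ε ^ 2 * r ^ 2, mul_pos (pow_pos hε.1 2) (pow_pos hr0 2), ?_⟩
      filter_upwards [eventually_ge_atTop 1, herr, hyx_lim.eventually_lt_const hr0]
        with n hn hen hyn hs
      have hS : sumSqDisp m c g Cm (y n) < r ^ 2 := lt_of_mul_lt_mul_left hs (sq_nonneg ε)
      have hfeas := constraint_le_of_small_displacement hg huc hM hgM hr1 (hR _ (hxK n hn))
        ((hyx n hn).trans hyn.le) (norm_displacement_le_of_sumSqDisp_le hr0.le hS.le)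
      have h1 := hρu (x n) (hxK n hn) fun i hi => (hfeas i hi).trans hr
      have h2 : 2 * μ * (-(e / (4 * μ))) ≤ 2 * μ * inner ℝ (F u) (x n - u) := by gcongr
      have h3 : 2 * μ * (-(e / (4 * μ))) = -(e / 2) := by field_simp; norm_num
      -- Only `x n` is known to lie in `Cm`, so the passage from `y n` to `x n` is charged to the
      -- error.
      have h4 : inner ℝ (F u) (y n - u) = inner ℝ (F u) (x n - u)
          + inner ℝ (F u) (y n - x n) := by
        rw [← inner_add_right]; congr 1; abel
      have h5 := hFin (y n - x n)
      have h6 : ‖F u‖ * ‖y n - x n‖ ≤ ‖F u‖ * (μ * B * β n) := by gcongr; exact hyx n hn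
      have h7 : 2 * μ * (φ n * inner ℝ (y n - u) (d (n - 1)) - inner ℝ (F u) (y n - x n))
          ≤ 2 * μ * ((μ * B + 2 * R) * B * φ n + ‖F u‖ * (μ * B * β n)) := by
        gcongr
        linarith [hφd n hn]
      rw [h4]
      linarith
  have hsqrt : Tendsto (fun n => ‖x n - u‖) atTop (𝓝 0) := by
    have h := hlim.sqrt
    simpa [Real.sqrt_sq (norm_nonneg _)] using h
  exact tendsto_iff_norm_sub_tendsto_zero.2 hsqrt
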